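/- Let $\varepsilon>0$ and let $p=p(n)\in[0,1]$ satisfy $p=\omega\left(\frac{\log n}{n}\right)$ as $n\to\infty$ over the even integers. For even $n$, let $V_1,V_2$ be disjoint vertex sets, each of size $n/2$, and let $G_1,\dots,G_{n/2}$ be independent samples of the random bipartite graph $B(n,p)$ on $V_1\cup V_2$, in which each pair in $V_1\times V_2$ is an edge with probability $p$, independently of all other pairs, and there are no other edges. Then, with probability tending to $1$ as $n\to\infty$ over the even integers, the following holds: for all spanning subgraphs $H_i\subseteq G_i$, $1\le i\le n/2$, with minimum degree $\delta(H_i)\ge\left(\frac12+\varepsilon\right)\frac{np}{2}$ for every $i$, the family $\{H_1,\dots,H_{n/2}\}$ admits a rainbow perfect matching, that is, there are edges $e_i\in E(H_i)$, $1\le i\le n/2$, such that $e_1,\dots,e_{n/2}$ are distinct and form a perfect matching of $V_1\cup V_2$. -/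

import Mathlib

open Filter Topology Asymptotics MeasureTheory ProbabilityTheory unitInterval

/-- The binomial random bipartite graph with parts `V` and `W`: each pair in `V × W` is an edge
with probability `p`, independently of all other pairs, and there are no other edges. It is
given as a law on the graphs with vertex set `V ⊕ W`. -/
noncomputable def bipartiteBinomialRandom (V W : Type*) (p : I) :
    Measure (SimpleGraph (V ⊕ W)) :=
  (setBernoulli (completeBipartiteGraph V W).edgeSet p).map SimpleGraph.fromEdgeSet

instance (V W : Type*) [Countable V] [Countable W] (p : I) :
    IsProbabilityMeasure (bipartiteBinomialRandom V W p) :=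
  Measure.isProbabilityMeasure_map SimpleGraph.measurable_fromEdgeSet.aemeasurable

open scoped Classical in
/-- The minimum degree of a graph on a finite vertex set. -/
noncomputable def minDeg {V : Type*} [Fintype V] (G : SimpleGraph V) : ℕ := G.minDegree

/-- The family `H` of graphs on the vertex set `V` has a rainbow perfect matching: a perfect
matching `M` of the union of the family, together with a bijection `φ` from the index set onto
the edge set of `M` such that `φ i` is an edge of `H i`. -/
def HasRainbowPerfectMatching {V ι : Type*} (H : ι → SimpleGraph V) : Prop :=
  ∃ M : (⨆ i, H i).Subgraph, M.IsPerfectMatching ∧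
    ∃ φ : ι ≃ M.edgeSet, ∀ i, (φ i : Sym2 V) ∈ (H i).edgeSet

/-! Write `m = n / 2` and `d = m * p`. A permutation `π` assigns the graph with index `π x` to each
left vertex `x`. Let `B_π` join `x` to its neighbours in `H (π x)`; a perfect matching of `B_π` is a
rainbow perfect matching of `H`. It therefore suffices to find one `π` for which Hall's condition
holds.

Left degrees in `B_π` are large by hypothesis. Right degrees are not: the graphs assigned may all be
ones in which the edges at `y` were deleted. For random `π` this is unlikely. Over all indices, at
most about `m * d * (1/2 - 3ε/4)` edges at `y` are deleted, and a factorial moment bound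
(`card_perm_ge_le`) shows that the graph of `π` rarely meets many more of them than the average.

Since `H` is chosen after `G`, no union bound over `H` is affordable. What is asked of the random
family concerns `G` alone: few edges in all at each `y`, and `IsSpread` for more than half of the
permutations. The latter follows from Chernoff bounds for fixed `π` and Markov's inequality. The
choice of `H` is then handled by the randomness of `π` (`hasRainbowPerfectMatching_of_spread`). -/

/-! ### Edge counts in the random family and their exponential tails -/

open scoped Classical in
/-- The number of triples `(i, x, y)` of `F` for which `x` and `y` are adjacent in `G i`. -/
noncomputable def edgeCount {ι V W : Type*} (G : ι → SimpleGraph (V ⊕ W))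
    (F : Finset (ι × V × W)) : ℕ :=
  (F.filter fun t => (G t.1).Adj (Sum.inl t.2.1) (Sum.inr t.2.2)).card

instance SimpleGraph.measurableSingletonClass_of_finite {V : Type*} [Finite V] :
    MeasurableSingletonClass (SimpleGraph V) where
  measurableSet_singleton G := by
    have : ({G} : Set (SimpleGraph V)) = SimpleGraph.edgeSet ⁻¹' {G.edgeSet} := by
      ext G'; simp
    rw [this]
    exact SimpleGraph.measurable_edgeSet (measurableSet_singleton _)

lemma integral_bernoulli_prop (p : I) (f : Prop → ℝ) (q : Prop) :
    ∫ b, f b ∂((unitInterval.toNNReal p) • Measure.dirac q +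
        (unitInterval.toNNReal (unitInterval.symm p)) • Measure.dirac False) =
      (p : ℝ) * f q + (1 - p) * f False := by
  rw [integral_add_measure Integrable.of_finite Integrable.of_finite,
    integral_smul_nnreal_measure, integral_smul_nnreal_measure, integral_dirac, integral_dirac]
  simp [NNReal.smul_def]

open scoped Classical in
lemma integral_prod_bipartiteBinomialRandom {V W : Type*} [Fintype V] [Fintype W] (p : I)
    (F : Finset (V × W)) (c : ℝ) :
    ∫ G, c ^ (F.filter fun t => G.Adj (Sum.inl t.1) (Sum.inr t.2)).card
      ∂(bipartiteBinomialRandom V W p) = (1 + p * (c - 1)) ^ F.card := by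
  have hinj : Function.Injective fun t : V × W => s(Sum.inl t.1, Sum.inr t.2) := by
    rintro ⟨a, b⟩ ⟨a', b'⟩ h
    simpa using h
  set F' : Finset (Sym2 (V ⊕ W)) := F.image fun t => s(Sum.inl t.1, Sum.inr t.2) with hF'
  have hm : Measurable (fun P : Sym2 (V ⊕ W) → Prop => {e | P e}) :=
    MeasurableEquiv.setOfPred.measurable
  rw [bipartiteBinomialRandom, integral_map SimpleGraph.measurable_fromEdgeSet.aemeasurable
    (.of_discrete), setBernoulli_eq_map,
    integral_map hm.aemeasurable (.of_discrete), Measure.infinitePi_eq_pi]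
  -- Pairs outside `F'` get the factor 1, so the integrand is a product over all coordinates of the
  -- product measure.
  have hint : ∀ P : Sym2 (V ⊕ W) → Prop,
      c ^ (F.filter fun t => (SimpleGraph.fromEdgeSet {e | P e}).Adj
        (Sum.inl t.1) (Sum.inr t.2)).card = ∏ e, if e ∈ F' ∧ P e then c else 1 := by
    intro P
    rw [Finset.prod_ite, Finset.prod_const_one, mul_one, Finset.prod_const]
    congr 1
    rw [← Finset.card_image_of_injective _ hinj]
    congr 1
    ext e
    simp only [Finset.mem_image, Finset.mem_filter, hF', Finset.mem_univ, true_and]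
    constructor
    · rintro ⟨t, ⟨ht, h⟩, rfl⟩
      exact ⟨⟨t, ht, rfl⟩, by simpa using h⟩
    · rintro ⟨⟨t, ht, rfl⟩, h⟩
      exact ⟨t, ⟨ht, by simpa using h⟩, rfl⟩
  refine (integral_congr_ae (g := fun P : Sym2 (V ⊕ W) → Prop => ∏ e, if e ∈ F' ∧ P e then c else 1)
    (.of_forall fun P => by simp only [← hint P]; congr!)).trans ?_
  rw [integral_fintype_prod_eq_prod (𝕜 := ℝ)
    (f := fun (e : Sym2 (V ⊕ W)) (b : Prop) => if e ∈ F' ∧ b then c else 1)]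
  have hval : ∀ e : Sym2 (V ⊕ W),
      ∫ b, (if e ∈ F' ∧ b then c else 1) ∂((unitInterval.toNNReal p) •
        Measure.dirac (e ∈ (completeBipartiteGraph V W).edgeSet) +
        (unitInterval.toNNReal (unitInterval.symm p)) • Measure.dirac False) =
      if e ∈ F' then 1 + p * (c - 1) else 1 := by
    intro e
    rw [integral_bernoulli_prop p (fun b => if e ∈ F' ∧ b then c else 1)]
    by_cases he : e ∈ F'
    · have : e ∈ (completeBipartiteGraph V W).edgeSet := by
        obtain ⟨t, -, rfl⟩ := Finset.mem_image.1 he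
        simp
      simp only [he, this, and_self, if_true, and_false, if_false]
      ring
    · simp [he]
  rw [Finset.prod_congr rfl fun e _ => hval e, Finset.prod_ite, Finset.prod_const_one, mul_one,
    Finset.prod_const, Finset.filter_mem_eq_inter, Finset.univ_inter, hF',
    Finset.card_image_of_injective _ hinj]

lemma integral_pow_edgeCount {ι V W : Type*} [Fintype ι] [Fintype V] [Fintype W] (p : I)
    (F : Finset (ι × V × W)) (c : ℝ) :
    ∫ G, c ^ edgeCount G F ∂(Measure.pi fun _ : ι => bipartiteBinomialRandom V W p) =
      (1 + p * (c - 1)) ^ F.card := by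
  classical
  let Fi : ι → Finset (V × W) := fun i => Finset.univ.filter fun t => (i, t) ∈ F
  have hcard : ∀ q : ι × V × W → Prop, (F.filter q).card =
      ∑ i, ((Fi i).filter fun t => q (i, t)).card := by
    intro q
    rw [Finset.card_eq_sum_card_fiberwise (f := Prod.fst) (t := Finset.univ) (by simp)]
    refine Finset.sum_congr rfl fun i _ => ?_
    refine Finset.card_bij' (fun t _ => t.2) (fun t _ => (i, t)) ?_ ?_ ?_ ?_
    · rintro ⟨j, t⟩ h
      simp only [Finset.mem_filter] at h
      obtain ⟨⟨h1, h2⟩, rfl⟩ := h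
      simp [Fi, h1, h2]
    · rintro t h
      simpa [Fi] using h
    · rintro ⟨j, t⟩ h
      simp only [Finset.mem_filter] at h
      simp [h.2]
    · simp
  have hint : ∀ G : ι → SimpleGraph (V ⊕ W), c ^ edgeCount G F =
      ∏ i, c ^ ((Fi i).filter fun t => (G i).Adj (Sum.inl t.1) (Sum.inr t.2)).card := by
    intro G
    rw [Finset.prod_pow_eq_pow_sum, edgeCount, hcard]
  simp_rw [hint]
  rw [integral_fintype_prod_eq_prod (𝕜 := ℝ) (f := fun i (G : SimpleGraph (V ⊕ W)) =>
    c ^ ((Fi i).filter fun t => G.Adj (Sum.inl t.1) (Sum.inr t.2)).card)]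
  rw [Finset.prod_congr rfl fun i _ => integral_prod_bipartiteBinomialRandom p (Fi i) c,
    Finset.prod_pow_eq_pow_sum]
  congr 1
  simpa using (hcard fun _ => True).symm

/-- Uses `exp t - 1 ≤ t + t ^ 2` for `|t| ≤ 1`, then `1 + x ≤ exp x`. Both signs of `t` are needed,
one for each tail. -/
lemma mgf_edgeCount_le {ι V W : Type*} [Fintype ι] [Fintype V] [Fintype W] (p : I)
    (F : Finset (ι × V × W)) {t : ℝ} (ht : |t| ≤ 1) :
    mgf (fun G => (edgeCount G F : ℝ)) (Measure.pi fun _ : ι => bipartiteBinomialRandom V W p) t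
      ≤ Real.exp (F.card * p * (t + t ^ 2)) := by
  have h1 : mgf (fun G => (edgeCount G F : ℝ))
      (Measure.pi fun _ : ι => bipartiteBinomialRandom V W p) t =
      (1 + p * (Real.exp t - 1)) ^ F.card := by
    rw [mgf, ← integral_pow_edgeCount]
    congr 1
    ext G
    rw [← Real.exp_nat_mul, mul_comm]
  have h2 := abs_le.1 (Real.abs_exp_sub_one_sub_id_le ht)
  have hp := p.2.1
  have hp1 := p.2.2
  have h0 := Real.exp_pos t
  rw [h1, mul_assoc, Real.exp_nat_mul]
  refine pow_le_pow_left₀ (by nlinarith) ?_ _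
  have := Real.add_one_le_exp ((p : ℝ) * (t + t ^ 2))
  nlinarith

lemma measureReal_le_edgeCount_le {ι V W : Type*} [Fintype ι] [Fintype V] [Fintype W] (p : I)
    (F : Finset (ι × V × W)) {t : ℝ} (ht0 : 0 ≤ t) (ht : t ≤ 1) (a : ℝ) :
    (Measure.pi fun _ : ι => bipartiteBinomialRandom V W p).real {G | a ≤ edgeCount G F}
      ≤ Real.exp (F.card * p * (t + t ^ 2) - t * a) := by
  refine (measure_ge_le_exp_mul_mgf a ht0 Integrable.of_finite).trans ?_
  rw [sub_eq_neg_add, Real.exp_add, neg_mul]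
  gcongr
  exact mgf_edgeCount_le p F (by rwa [abs_of_nonneg ht0])

lemma measureReal_edgeCount_le_le {ι V W : Type*} [Fintype ι] [Fintype V] [Fintype W] (p : I)
    (F : Finset (ι × V × W)) {t : ℝ} (ht0 : 0 ≤ t) (ht : t ≤ 1) (a : ℝ) :
    (Measure.pi fun _ : ι => bipartiteBinomialRandom V W p).real {G | (edgeCount G F : ℝ) ≤ a}
      ≤ Real.exp (F.card * p * (t ^ 2 - t) + t * a) := by
  refine (measure_le_le_exp_mul_mgf a (neg_nonpos.2 ht0) Integrable.of_finite).trans ?_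
  rw [add_comm, Real.exp_add, neg_neg]
  gcongr
  refine (mgf_edgeCount_le p F (by rwa [abs_neg, abs_of_nonneg ht0])).trans_eq ?_
  ring_nf

lemma ae_le_completeBipartiteGraph {ι V W : Type*} [Fintype ι] [Fintype V] [Fintype W] (p : I) :
    ∀ᵐ G ∂(Measure.pi fun _ : ι => bipartiteBinomialRandom V W p),
      ∀ i, G i ≤ completeBipartiteGraph V W := by
  rw [ae_all_iff]
  intro i
  have h : ∀ᵐ G ∂(bipartiteBinomialRandom V W p), G ≤ completeBipartiteGraph V W := by
    rw [bipartiteBinomialRandom, ae_map_iff SimpleGraph.measurable_fromEdgeSet.aemeasurable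
      (.of_discrete)]
    filter_upwards [setBernoulli_ae_subset] with s hs
    rw [← SimpleGraph.edgeSet_subset_edgeSet, SimpleGraph.edgeSet_fromEdgeSet]
    exact Set.sdiff_subset.trans hs
  exact (measurePreserving_eval (fun _ : ι => bipartiteBinomialRandom V W p) i)
    |>.quasiMeasurePreserving.ae h

/-! ### Hall's condition, and rainbow matchings from two permutations -/

open scoped Classical in
/-- Perfect matchings in balanced bipartite graphs with few edges between small sets. -/
lemma exists_perm_of_sparse {m : ℕ} (r : Fin m → Fin m → Prop) {δ : ℝ} (hδ : 0 < δ)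
    (hrow : ∀ x, δ ≤ ((Finset.univ.filter fun y => r x y).card : ℝ))
    (hcol : ∀ y, δ ≤ ((Finset.univ.filter fun x => r x y).card : ℝ))
    (hsparse : ∀ S T : Finset (Fin m), T.card = S.card → 0 < S.card → 2 * S.card ≤ m →
      (((S ×ˢ T).filter fun t => r t.1 t.2).card : ℝ) < δ * S.card) :
    ∃ τ : Equiv.Perm (Fin m), ∀ x, r x (τ x) := by
  obtain ⟨f, hf, hr⟩ : ∃ f : Fin m → Fin m, Function.Injective f ∧ ∀ x, r x (f x) := by
    rw [← Fintype.all_card_le_filter_rel_iff_exists_injective]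
    intro S
    by_contra! hlt
    set N : Finset (Fin m) := Finset.univ.filter fun b => ∃ a ∈ S, r a b with hN
    replace hlt : N.card < S.card := by
      refine lt_of_eq_of_lt ?_ hlt
      congr!
    have hScard : S.card ≤ m := by simpa using S.card_le_univ
    have hSpos : 0 < S.card := by omega
    rcases le_or_gt (2 * S.card) m with hS | hS
    -- The neighbourhood of `S` is padded to a set `T` of size `|S|`; every edge at `S` lands in
    -- `T`, which is too many edges.
    · obtain ⟨T, hNT, -, hT⟩ := Finset.exists_subsuperset_card_eq (Finset.subset_univ N) hlt.le
        (by simpa using hScard)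
      have h := hsparse S T hT hSpos hS
      have heq : ((S ×ˢ T).filter fun t => r t.1 t.2).card =
          ∑ x ∈ S, (Finset.univ.filter fun y => r x y).card := by
        rw [Finset.card_filter, Finset.sum_product]
        refine Finset.sum_congr rfl fun x hx => ?_
        rw [← Finset.card_filter]
        congr 1
        ext y
        simp only [Finset.mem_filter, Finset.mem_univ, true_and, and_iff_right_iff_imp]
        exact fun hxy => hNT (by simpa [hN] using ⟨x, hx, hxy⟩)
      rw [heq, Nat.cast_sum] at h
      have := Finset.card_nsmul_le_sum S _ δ fun x _ => hrow x
      rw [nsmul_eq_mul] at this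
      linarith
    · have hSc : Sᶜ.card = m - S.card := by simp [Finset.card_compl]
      have hNc : Nᶜ.card = m - N.card := by simp [Finset.card_compl]
      have key : ∀ y ∈ Nᶜ, ∀ x, r x y → x ∈ Sᶜ := by
        intro y hy x hxy
        simp only [hN, Finset.mem_compl, Finset.mem_filter, Finset.mem_univ, true_and] at hy ⊢
        exact fun hx => hy ⟨x, hx, hxy⟩
      -- For large `S` the roles of the sides are exchanged: vertices outside `N` have all their
      -- neighbours in `Sᶜ`, which is small. If `Sᶜ` is empty, sparsity says nothing, but then such
      -- a vertex is isolated.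
      rcases Nat.eq_zero_or_pos Sᶜ.card with h0 | hpos
      · obtain ⟨y, hy⟩ : Nᶜ.Nonempty := Finset.card_pos.1 (by omega)
        have hz : (Finset.univ.filter fun x => r x y) = ∅ := by
          rw [Finset.filter_eq_empty_iff]
          intro x _ hxy
          have := key y hy x hxy
          rw [Finset.card_eq_zero.1 h0] at this
          simp at this
        have := hcol y
        rw [hz] at this
        simp at this
        linarith
      · obtain ⟨T, hTN, hT⟩ := Finset.exists_subset_card_eq (show Sᶜ.card ≤ Nᶜ.card by omega)
        have h := hsparse Sᶜ T hT hpos (by omega)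
        have heq : ((Sᶜ ×ˢ T).filter fun t => r t.1 t.2).card =
            ∑ y ∈ T, (Finset.univ.filter fun x => r x y).card := by
          rw [Finset.card_filter, Finset.sum_product_right]
          refine Finset.sum_congr rfl fun y hy => ?_
          rw [← Finset.card_filter]
          congr 1
          ext x
          simp only [Finset.mem_filter, Finset.mem_univ, true_and, and_iff_right_iff_imp]
          exact key y (hTN hy) x
        rw [heq, Nat.cast_sum] at h
        have := Finset.card_nsmul_le_sum T _ δ fun y _ => hcol y
        rw [nsmul_eq_mul, hT] at this
        linarith
  exact ⟨Equiv.ofBijective f (Finite.injective_iff_bijective.1 hf), hr⟩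

lemma hasRainbowPerfectMatching_of_perm {m : ℕ}
    (H : Fin m → SimpleGraph (Fin m ⊕ Fin m)) (π τ : Equiv.Perm (Fin m))
    (h : ∀ x, (H (π x)).Adj (Sum.inl x) (Sum.inr (τ x))) : HasRainbowPerfectMatching H := by
  let e : Fin m → Sym2 (Fin m ⊕ Fin m) := fun x => s(Sum.inl x, Sum.inr (τ x))
  have he : Function.Injective e := by
    intro x y hxy
    simp only [e, Sym2.eq_iff] at hxy
    simpa using hxy
  have hsup : ∀ x, (⨆ i, H i).Adj (Sum.inl x) (Sum.inr (τ x)) := fun x =>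
    SimpleGraph.iSup_adj.2 ⟨_, h x⟩
  let M : (⨆ i, H i).Subgraph :=
    { verts := Set.univ
      Adj := fun u v => s(u, v) ∈ Set.range e
      adj_sub := by
        rintro u v ⟨x, hx⟩
        rw [← SimpleGraph.mem_edgeSet, ← hx]
        exact hsup x
      edge_vert := fun _ => Set.mem_univ _
      symm := ⟨fun u v huv => by rwa [Sym2.eq_swap]⟩ }
  have hM : M.edgeSet = Set.range e := by
    ext z
    induction z with
    | _ u v => rfl
  refine ⟨M, ?_, π.symm.trans ((Equiv.ofInjective e he).trans (Equiv.setCongr hM.symm)), ?_⟩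
  · rw [SimpleGraph.Subgraph.isPerfectMatching_iff]
    rintro (x | y)
    · refine ⟨Sum.inr (τ x), ⟨x, rfl⟩, ?_⟩
      rintro v ⟨x', hx'⟩
      simp only [e, Sym2.eq_iff] at hx'
      aesop
    · refine ⟨Sum.inl (τ.symm y), ⟨τ.symm y, by simp [e, Sym2.eq_swap]⟩, ?_⟩
      rintro v ⟨x', hx'⟩
      simp only [e, Sym2.eq_iff] at hx'
      aesop
  · intro i
    have := h (π.symm i)
    rw [Equiv.apply_symm_apply] at this
    exact this

/-! ### Points of a set on the graph of a random permutation -/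

open scoped Classical in
lemma card_perm_agree {α : Type*} [Fintype α] (J : Finset α) (π₀ : Equiv.Perm α) :
    (Finset.univ.filter fun π : Equiv.Perm α => ∀ x ∈ J, π x = π₀ x).card =
      (Fintype.card α - J.card).factorial := by
  have h1 : (Finset.univ.filter fun π : Equiv.Perm α => ∀ x ∈ J, π x = π₀ x).card =
      (Finset.univ.filter fun ρ : Equiv.Perm α => ∀ x, ¬ x ∉ J → ρ x = x).card := by
    refine Finset.card_equiv (Equiv.mulLeft π₀⁻¹) fun π => ?_
    simp [Equiv.symm_apply_eq]
  rw [h1, ← Fintype.card_subtype,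
    ← Fintype.card_congr (Equiv.Perm.subtypeEquivSubtypePerm fun x => x ∉ J), Fintype.card_perm]
  congr 1
  rw [Fintype.card_subtype_compl, Fintype.card_coe]

open scoped Classical in
/-- Factorial moments of the number of points of a set on the graph of a random permutation. -/
lemma sum_perm_choose_le {α : Type*} [Fintype α] (A : Finset (α × α)) (k : ℕ) :
    ∑ π : Equiv.Perm α, ((A.filter fun t => π t.1 = t.2).card).choose k ≤
      A.card.choose k * (Fintype.card α - k).factorial := by
  -- The binomial coefficient counts the `k`-subsets of `A` lying on the graph of `π`. After
  -- exchanging sums, each such subset lies on at most `(|α| - k)!` graphs.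
  have h1 : ∀ π : Equiv.Perm α, ((A.filter fun t => π t.1 = t.2).card).choose k =
      ∑ K ∈ A.powersetCard k, if ∀ t ∈ K, π t.1 = t.2 then 1 else 0 := by
    intro π
    rw [← Finset.card_filter, ← Finset.card_powersetCard]
    congr 1
    ext K
    simp only [Finset.mem_powersetCard, Finset.mem_filter, Finset.subset_iff]
    grind
  simp_rw [h1]
  rw [Finset.sum_comm, ← Finset.card_powersetCard k A, ← smul_eq_mul]
  refine Finset.sum_le_card_nsmul _ _ _ fun K hK => ?_
  rw [← Finset.card_filter]
  rcases (Finset.univ.filter fun π : Equiv.Perm α => ∀ t ∈ K, π t.1 = t.2).eq_empty_or_nonempty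
    with h | ⟨π₀, h⟩
  · rw [h]; simp
  · simp only [Finset.mem_filter, Finset.mem_univ, true_and] at h
    have hinj : Set.InjOn Prod.fst (K : Set (α × α)) := by
      intro s hs t ht hst
      exact Prod.ext hst (by rw [← h s hs, ← h t ht, hst])
    have hk : (K.image Prod.fst).card = k := by
      rw [Finset.card_image_of_injOn hinj, (Finset.mem_powersetCard.1 hK).2]
    rw [← hk, ← card_perm_agree _ π₀]
    refine Finset.card_le_card fun π hπ => ?_
    simp only [Finset.mem_filter, Finset.mem_univ, true_and] at hπ ⊢
    intro x hx
    obtain ⟨t, ht, rfl⟩ := Finset.mem_image.1 hx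
    rw [hπ t ht, h t ht]

open scoped Classical in
lemma card_perm_ge_mul_choose_le {α : Type*} [Fintype α] (A : Finset (α × α)) (a k : ℕ) :
    (Finset.univ.filter fun π : Equiv.Perm α =>
        a ≤ (A.filter fun t => π t.1 = t.2).card).card * a.choose k ≤
      A.card.choose k * (Fintype.card α - k).factorial := by
  refine le_trans ?_ (sum_perm_choose_le A k)
  rw [← smul_eq_mul]
  refine (Finset.card_nsmul_le_sum _ _ _ fun π hπ => ?_).trans
    (Finset.sum_le_sum_of_subset (Finset.subset_univ _))
  exact Nat.choose_le_choose k (Finset.mem_filter.1 hπ).2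

open scoped Classical in
/-- Upper tail of the number of points of a set on the graph of a random permutation. -/
lemma card_perm_ge_le {α : Type*} [Fintype α] (A : Finset (α × α)) {a k : ℕ} (hka : k < a)
    (hk : k < Fintype.card α) :
    ((Finset.univ.filter fun π : Equiv.Perm α =>
        a ≤ (A.filter fun t => π t.1 = t.2).card).card : ℝ) ≤
      (A.card / ((a - k) * (Fintype.card α - k)) : ℝ) ^ k * (Fintype.card α).factorial := by
  set N := (Finset.univ.filter fun π : Equiv.Perm α =>
    a ≤ (A.filter fun t => π t.1 = t.2).card).card
  set m := Fintype.card α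
  have h := card_perm_ge_mul_choose_le A a k
  have h2 : N * a.descFactorial k * m.descFactorial k ≤ A.card ^ k * m.factorial := by
    rw [← Nat.factorial_mul_descFactorial hk.le, Nat.descFactorial_eq_factorial_mul_choose a]
    calc N * (k.factorial * a.choose k) * m.descFactorial k
        = (N * a.choose k) * k.factorial * m.descFactorial k := by ring
      _ ≤ (A.card.choose k * (m - k).factorial) * k.factorial * m.descFactorial k := by gcongr
      _ = A.card.descFactorial k * ((m - k).factorial * m.descFactorial k) := by
        rw [Nat.descFactorial_eq_factorial_mul_choose A.card]; ring
      _ ≤ _ := by gcongr; exact Nat.descFactorial_le_pow _ _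
  have hpow : ∀ n : ℕ, k < n → ((n : ℝ) - k) ^ k ≤ n.descFactorial k := by
    intro n hn
    have : (n - k) ^ k ≤ n.descFactorial k :=
      (Nat.pow_le_pow_left (by omega) k).trans (Nat.pow_sub_le_descFactorial n k)
    rw [← Nat.cast_sub hn.le]
    exact_mod_cast this
  have ha : (0 : ℝ) < a - k := sub_pos.2 (by exact_mod_cast hka)
  have hm : (0 : ℝ) < m - k := sub_pos.2 (by exact_mod_cast hk)
  rw [div_pow, div_mul_eq_mul_div, le_div_iff₀ (by positivity), mul_pow, ← mul_assoc]
  calc (N : ℝ) * (a - k) ^ k * (m - k) ^ k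
      ≤ N * a.descFactorial k * m.descFactorial k := by
        gcongr
        · exact hpow a hka
        · exact hpow m hk
    _ ≤ _ := by exact_mod_cast h2

/-! ### Spread permutations and the relevant edge counts -/

/-- The triples `(π x, x, y)` with `x ∈ S` and `y ∈ T`. -/
def transversalTriples {m : ℕ} (π : Equiv.Perm (Fin m)) (S T : Finset (Fin m)) :
    Finset (Fin m × Fin m × Fin m) :=
  (S ×ˢ T).map ⟨fun t => (π t.1, t.1, t.2), fun s t h => by
    simp only [Prod.mk.injEq] at h; exact Prod.ext h.2.1 h.2.2⟩

/-- The triples with last entry `y`. -/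
def starTriples {m : ℕ} (y : Fin m) : Finset (Fin m × Fin m × Fin m) :=
  Finset.univ.filter fun t => t.2.2 = y

/-- The bipartite graph joining `x` to its neighbours in `G (π x)` has degrees close to `d` in the
second part and few edges between small sets. -/
def IsSpread {m : ℕ} (η d : ℝ) (G : Fin m → SimpleGraph (Fin m ⊕ Fin m))
    (π : Equiv.Perm (Fin m)) : Prop :=
  (∀ y, (1 - η) * d < edgeCount G (transversalTriples π Finset.univ {y})) ∧
    ∀ S T : Finset (Fin m), T.card = S.card → 0 < S.card → 2 * S.card ≤ m →
      (edgeCount G (transversalTriples π S T) : ℝ) < (1 / 2 + η) * d * S.card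

open scoped Classical in
lemma edgeCount_transversalTriples {m : ℕ} (G : Fin m → SimpleGraph (Fin m ⊕ Fin m))
    (π : Equiv.Perm (Fin m)) (S T : Finset (Fin m)) :
    edgeCount G (transversalTriples π S T) =
      ((S ×ˢ T).filter fun t => (G (π t.1)).Adj (Sum.inl t.1) (Sum.inr t.2)).card := by
  rw [edgeCount, transversalTriples, Finset.filter_map, Finset.card_map]
  rfl

open scoped Classical in
lemma edgeCount_transversalTriples_singleton {m : ℕ} (G : Fin m → SimpleGraph (Fin m ⊕ Fin m))
    (π : Equiv.Perm (Fin m)) (y : Fin m) :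
    edgeCount G (transversalTriples π Finset.univ {y}) =
      (Finset.univ.filter fun x => (G (π x)).Adj (Sum.inl x) (Sum.inr y)).card := by
  rw [edgeCount_transversalTriples, Finset.product_singleton, Finset.filter_map, Finset.card_map]
  rfl

open scoped Classical in
lemma edgeCount_starTriples {m : ℕ} (G : Fin m → SimpleGraph (Fin m ⊕ Fin m)) (y : Fin m) :
    edgeCount G (starTriples y) = (Finset.univ.filter fun t : Fin m × Fin m =>
      (G t.2).Adj (Sum.inl t.1) (Sum.inr y)).card := by
  refine Finset.card_bij' (fun t _ => (t.2.1, t.1)) (fun t _ => (t.2, t.1, y)) ?_ ?_ ?_ ?_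
  · rintro ⟨i, x, z⟩ h
    simp only [starTriples, Finset.mem_filter, Finset.mem_univ, true_and] at h ⊢
    obtain ⟨rfl, h⟩ := h
    exact h
  · rintro ⟨x, i⟩ h
    simpa [starTriples] using h
  · rintro ⟨i, x, z⟩ h
    simp only [starTriples, Finset.mem_filter, Finset.mem_univ, true_and] at h ⊢
    rw [h.1]
  · simp

open scoped Classical in
lemma minDeg_le_card_right {V W : Type*} [Fintype V] [Fintype W] {G : SimpleGraph (V ⊕ W)}
    (hG : G ≤ completeBipartiteGraph V W) (y : W) :
    minDeg G ≤ (Finset.univ.filter fun x => G.Adj (Sum.inl x) (Sum.inr y)).card := by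
  refine (G.minDegree_le_degree (Sum.inr y)).trans ?_
  rw [← SimpleGraph.card_neighborFinset_eq_degree,
    ← Finset.card_map (⟨Sum.inl, Sum.inl_injective⟩ : V ↪ V ⊕ W)]
  refine Finset.card_le_card fun v hv => ?_
  rw [SimpleGraph.mem_neighborFinset] at hv
  have := hG hv
  rcases v with x | z
  · simpa using hv.symm
  · simp at this

open scoped Classical in
lemma minDeg_le_card_left {V W : Type*} [Fintype V] [Fintype W] {G : SimpleGraph (V ⊕ W)}
    (hG : G ≤ completeBipartiteGraph V W) (x : V) :
    minDeg G ≤ (Finset.univ.filter fun y => G.Adj (Sum.inl x) (Sum.inr y)).card := by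
  refine (G.minDegree_le_degree (Sum.inl x)).trans ?_
  rw [← SimpleGraph.card_neighborFinset_eq_degree,
    ← Finset.card_map (⟨Sum.inr, Sum.inr_injective⟩ : W ↪ V ⊕ W)]
  refine Finset.card_le_card fun v hv => ?_
  rw [SimpleGraph.mem_neighborFinset] at hv
  have := hG hv
  rcases v with z | y
  · simp at this
  · simpa using hv

/-! ### The deterministic step: existence of a good permutation -/

/-- The bound `1 / (4 * m)` lets a union over the `m` right vertices cost only a quarter of all
permutations. -/
lemma card_perm_ge_le_of_card_le {m : ℕ} {ε d : ℝ} (hε : 0 < ε) (hε1 : ε ≤ 1 / 4) (hm : 0 < m)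
    (hdm : d ≤ m) (hd : 512 * Real.log (4 * m) ≤ ε ^ 2 * d) [DecidableEq (Fin m)]
    (A : Finset (Fin m × Fin m)) (hA : (A.card : ℝ) ≤ m * d * (1 / 2 - 3 / 4 * ε)) :
    ((Finset.univ.filter fun π : Equiv.Perm (Fin m) =>
        d * (1 / 2 - ε / 2) ≤ (A.filter fun t => π t.1 = t.2).card).card : ℝ) ≤
      1 / (4 * m) * m.factorial := by
  have hm1 : (1 : ℝ) ≤ m := by exact_mod_cast hm
  have hlog : 1 ≤ Real.log (4 * m) := by
    rw [Real.le_log_iff_exp_le (by positivity)]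
    linarith [Real.exp_one_lt_d9]
  have hεd : 2048 ≤ ε * d := by nlinarith
  have hd0 : 0 < d := by nlinarith
  -- A moment of order proportional to `ε * d` is small enough to keep the ratio below `1 - ε / 4`,
  -- and large enough that its `k`-th power beats `1 / (4 * m)`.
  set k := ⌊ε * d / 32⌋₊
  have hk1 : (k : ℝ) ≤ ε * d / 32 := Nat.floor_le (by positivity)
  have hk2 : ε * d / 64 ≤ k := by
    have := (Nat.lt_floor_add_one (ε * d / 32)).le
    change _ ≤ (k : ℝ) + 1 at this
    linarith
  set a := ⌈d * (1 / 2 - ε / 2)⌉₊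
  have ha : d * (1 / 2 - ε / 2) ≤ a := Nat.le_ceil _
  have hak : d * (1 / 2 - 17 / 32 * ε) ≤ (a : ℝ) - k := by linarith
  have hmk : m * (1 - ε / 32) ≤ (m : ℝ) - k := by nlinarith
  have h1 : 0 < d * (1 / 2 - 17 / 32 * ε) := mul_pos hd0 (by linarith)
  have h2 : 0 < m * (1 - ε / 32) := mul_pos (by linarith) (by linarith)
  have hka : k < a := by
    have : (k : ℝ) < a := by linarith
    exact_mod_cast this
  have hkm : k < Fintype.card (Fin m) := by
    have : (k : ℝ) < m := by linarith
    rw [Fintype.card_fin]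
    exact_mod_cast this
  have h := card_perm_ge_le A hka hkm
  have hratio : (A.card / ((a - k) * (m - k)) : ℝ) ≤ Real.exp (-(ε / 4)) := by
    refine le_trans ?_ (Real.one_sub_le_exp_neg _)
    rw [div_le_iff₀ (mul_pos (h1.trans_le hak) (h2.trans_le hmk))]
    calc (A.card : ℝ) ≤ (m * d) * (1 / 2 - 3 / 4 * ε) := hA
      _ ≤ (m * d) * ((1 - ε / 4) * ((1 / 2 - 17 / 32 * ε) * (1 - ε / 32))) := by
        gcongr
        -- To first order in `ε` the right-hand factor is `1/2 - 43ε/64`, against `1/2 - 48ε/64`.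
        nlinarith [mul_pos hε hε, mul_pos (mul_pos hε hε) hε,
          mul_nonneg (mul_pos hε hε).le (sub_nonneg.2 hε1)]
      _ = (1 - ε / 4) * ((d * (1 / 2 - 17 / 32 * ε)) * (m * (1 - ε / 32))) := by ring
      _ ≤ _ := by
        have := h1.trans_le hak
        gcongr
        linarith
  have hpow : (A.card / ((a - k) * (m - k)) : ℝ) ^ k ≤ 1 / (4 * m) := by
    calc (A.card / ((a - k) * (m - k)) : ℝ) ^ k ≤ Real.exp (-(ε / 4)) ^ k := by
          refine pow_le_pow_left₀ ?_ hratio _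
          exact div_nonneg (Nat.cast_nonneg _) (mul_pos (h1.trans_le hak) (h2.trans_le hmk)).le
      _ = Real.exp (k * -(ε / 4)) := (Real.exp_nat_mul _ _).symm
      _ ≤ Real.exp (-Real.log (4 * m)) := by
        gcongr
        nlinarith
      _ = 1 / (4 * m) := by
        rw [Real.exp_neg, Real.exp_log (by positivity), one_div]
  rw [Fintype.card_fin] at h
  refine le_trans ?_ (h.trans (by gcongr))
  refine Nat.cast_le.2 (Finset.card_le_card fun π hπ => ?_)
  simp only [Finset.mem_filter, Finset.mem_univ, true_and] at hπ ⊢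
  refine Nat.ceil_le.2 (hπ.trans (le_of_eq ?_))
  congr!

open scoped Classical in
/-- The deterministic statement: if most permutations are spread for `G`, then all subfamilies of
large minimum degree have a rainbow perfect matching. -/
lemma hasRainbowPerfectMatching_of_spread {m : ℕ} {ε d : ℝ} (hε : 0 < ε) (hε1 : ε ≤ 1 / 4)
    (hm : 0 < m) (hdm : d ≤ m) (hd : 512 * Real.log (4 * m) ≤ ε ^ 2 * d)
    {G H : Fin m → SimpleGraph (Fin m ⊕ Fin m)}
    (hG : ∀ i, G i ≤ completeBipartiteGraph (Fin m) (Fin m))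
    (hstar : ∀ y, (edgeCount G (starTriples y) : ℝ) < (1 + ε / 4) * (m * d))
    (hspread : ((Finset.univ.filter fun π => ¬ IsSpread (ε / 4) d G π).card : ℝ) <
      m.factorial / 2)
    (hHG : ∀ i, H i ≤ G i) (hH : ∀ i, (1 / 2 + ε) * d ≤ minDeg (H i)) :
    HasRainbowPerfectMatching H := by
  have hm0 : (0 : ℝ) < m := by exact_mod_cast hm
  have hd0 : 0 < d := by
    have h1 : 0 < Real.log (4 * m) := Real.log_pos (by
      have : (1 : ℝ) ≤ m := by exact_mod_cast hm
      linarith)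
    have := pow_pos hε 2
    by_contra! h
    nlinarith
  -- The deleted edges at `y`, coded as pairs (left vertex, index), so that those surviving in the
  -- choice `π` are points on its graph.
  let A : Fin m → Finset (Fin m × Fin m) := fun y => Finset.univ.filter fun t =>
    (G t.2).Adj (Sum.inl t.1) (Sum.inr y) ∧ ¬ (H t.2).Adj (Sum.inl t.1) (Sum.inr y)
  have hA : ∀ y, ((A y).card : ℝ) ≤ m * d * (1 / 2 - 3 / 4 * ε) := by
    intro y
    let Hy : Finset (Fin m × Fin m) := Finset.univ.filter fun t =>
      (H t.2).Adj (Sum.inl t.1) (Sum.inr y)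
    have h1 : (A y).card + Hy.card ≤ edgeCount G (starTriples y) := by
      rw [edgeCount_starTriples, ← Finset.card_union_of_disjoint]
      · refine Finset.card_le_card fun t ht => ?_
        simp only [A, Hy, Finset.mem_union, Finset.mem_filter, Finset.mem_univ, true_and] at ht ⊢
        exact ht.elim And.left fun h => hHG _ h
      · rw [Finset.disjoint_left]
        intro t ht ht'
        simp only [A, Hy, Finset.mem_filter, Finset.mem_univ, true_and] at ht ht'
        exact ht.2 ht'
    have h2 : Hy.card = ∑ i, (Finset.univ.filter fun x =>
        (H i).Adj (Sum.inl x) (Sum.inr y)).card := by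
      simp only [Hy, Finset.card_filter]
      rw [← Finset.univ_product_univ, Finset.sum_product_right]
    have h3 : m * ((1 / 2 + ε) * d) ≤ (Hy.card : ℝ) := by
      rw [h2, Nat.cast_sum]
      have := Finset.card_nsmul_le_sum Finset.univ (fun i => ((Finset.univ.filter fun x =>
        (H i).Adj (Sum.inl x) (Sum.inr y)).card : ℝ)) ((1 / 2 + ε) * d) fun i _ =>
          (hH i).trans (Nat.cast_le.2 (minDeg_le_card_right ((hHG i).trans (hG i)) y))
      simpa using this
    have h4 : ((A y).card : ℝ) + Hy.card ≤ edgeCount G (starTriples y) := by exact_mod_cast h1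
    linarith [hstar y]
  let bad : Fin m → Finset (Equiv.Perm (Fin m)) := fun y => Finset.univ.filter fun π =>
    d * (1 / 2 - ε / 2) ≤ ((A y).filter fun t => π t.1 = t.2).card
  have hbad : ∀ y, ((bad y).card : ℝ) ≤ 1 / (4 * m) * m.factorial := fun y => by
    convert card_perm_ge_le_of_card_le hε hε1 hm hdm hd (A y) (hA y)
  -- Fewer than half of the permutations are not spread, and at most a quarter are bad for some `y`.
  obtain ⟨π, hπ, hπbad⟩ : ∃ π, IsSpread (ε / 4) d G π ∧ ∀ y, π ∉ bad y := by
    by_contra! hcon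
    have hsub : (Finset.univ : Finset (Equiv.Perm (Fin m))) ⊆
        (Finset.univ.filter fun π => ¬ IsSpread (ε / 4) d G π) ∪ Finset.univ.biUnion bad := by
      intro π _
      by_cases h : IsSpread (ε / 4) d G π
      · obtain ⟨y, hy⟩ := hcon π h
        exact Finset.mem_union_right _ (Finset.mem_biUnion.2 ⟨y, Finset.mem_univ _, hy⟩)
      · exact Finset.mem_union_left _ (by simpa using h)
    have h1 := (Finset.card_le_card hsub).trans (Finset.card_union_le _ _)
    have h2 : ((Finset.univ.biUnion bad).card : ℝ) ≤ ∑ y, ((bad y).card : ℝ) := by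
      exact_mod_cast Finset.card_biUnion_le
    have h3 : ∑ y, ((bad y).card : ℝ) ≤ m * (1 / (4 * m) * m.factorial) := by
      simpa using Finset.sum_le_card_nsmul Finset.univ _ _ fun y _ => hbad y
    have h4 : (m : ℝ) * (1 / (4 * m) * m.factorial) = m.factorial / 4 := by
      field_simp
    rw [Finset.card_univ, Fintype.card_perm, Fintype.card_fin] at h1
    have h5 : (m.factorial : ℝ) ≤ (Finset.univ.filter fun π => ¬ IsSpread (ε / 4) d G π).card +
        (Finset.univ.biUnion bad).card := by exact_mod_cast h1
    have h6 : (0 : ℝ) < m.factorial := by exact_mod_cast m.factorial_pos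
    linarith
  suffices h : ∃ τ : Equiv.Perm (Fin m), ∀ x, (H (π x)).Adj (Sum.inl x) (Sum.inr (τ x)) from
    h.elim fun τ hτ => hasRainbowPerfectMatching_of_perm H π τ hτ
  refine exists_perm_of_sparse
    (fun x y => (H (π x)).Adj (Sum.inl x) (Sum.inr y)) (δ := (1 / 2 + ε / 4) * d)
    (by positivity) ?_ ?_ ?_
  · intro x
    refine le_trans ?_ ((hH (π x)).trans
      (Nat.cast_le.2 (minDeg_le_card_left ((hHG _).trans (hG _)) x)))
    gcongr
    linarith
  -- The constants meet here: `(1 - ε/4) * d - (1/2 - ε/2) * d = (1/2 + ε/4) * d`.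
  · intro y
    have h1 := hπ.1 y
    have h2 : (((A y).filter fun t => π t.1 = t.2).card : ℝ) < d * (1 / 2 - ε / 2) := by
      simpa [bad] using hπbad y
    have h3 : edgeCount G (transversalTriples π Finset.univ {y}) ≤
        (Finset.univ.filter fun x => (H (π x)).Adj (Sum.inl x) (Sum.inr y)).card +
          ((A y).filter fun t => π t.1 = t.2).card := by
      rw [edgeCount_transversalTriples_singleton]
      have : ((A y).filter fun t => π t.1 = t.2).card = (Finset.univ.filter fun x =>
          (G (π x)).Adj (Sum.inl x) (Sum.inr y) ∧
            ¬ (H (π x)).Adj (Sum.inl x) (Sum.inr y)).card := by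
        refine Finset.card_bij' (fun t _ => t.1) (fun x _ => (x, π x)) ?_ ?_ ?_ ?_
        · rintro ⟨x, i⟩ h
          simp only [A, Finset.mem_filter, Finset.mem_univ, true_and] at h ⊢
          obtain ⟨h, rfl⟩ := h
          exact h
        · intro x h
          simpa [A] using h
        · rintro ⟨x, i⟩ h
          simp only [Finset.mem_filter] at h
          rw [h.2]
        · simp
      rw [this]
      refine (Finset.card_le_card fun x hx => ?_).trans (Finset.card_union_le _ _)
      simp only [Finset.mem_union, Finset.mem_filter, Finset.mem_univ, true_and] at hx ⊢
      tauto
    have h4 : (edgeCount G (transversalTriples π Finset.univ {y}) : ℝ) ≤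
        (Finset.univ.filter fun x => (H (π x)).Adj (Sum.inl x) (Sum.inr y)).card +
          ((A y).filter fun t => π t.1 = t.2).card := by exact_mod_cast h3
    linarith
  · intro S T hT hS hSm
    refine lt_of_le_of_lt ?_ (hπ.2 S T hT hS hSm)
    rw [edgeCount_transversalTriples]
    refine Nat.cast_le.2 (Finset.card_le_card fun t ht => ?_)
    simp only [Finset.mem_filter] at ht ⊢
    exact ⟨ht.1, hHG _ ht.2⟩

/-! ### Failure probabilities for the random family -/

lemma card_transversalTriples {m : ℕ} (π : Equiv.Perm (Fin m)) (S T : Finset (Fin m)) :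
    (transversalTriples π S T).card = S.card * T.card := by
  rw [transversalTriples, Finset.card_map, Finset.card_product]

lemma card_starTriples {m : ℕ} (y : Fin m) :
    (starTriples y).card = m * m := by
  have : starTriples y = (Finset.univ : Finset (Fin m × Fin m)).map
      ⟨fun t => (t.1, t.2, y), fun s t h => by
        simp only [Prod.mk.injEq] at h; exact Prod.ext h.1 h.2.1⟩ := by
    ext ⟨i, x, z⟩
    simp only [starTriples, Finset.mem_filter, Finset.mem_univ, true_and, Finset.mem_map,
      Prod.exists]
    exact ⟨fun h => ⟨i, x, by rw [h]; rfl⟩, fun ⟨_, _, h⟩ => (congrArg (fun t => t.2.2) h).symm⟩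
  rw [this, Finset.card_map]
  simp

section Tail

variable {m : ℕ} {ε : ℝ} {p : I}

/-- The exponent `4 * s` beats the at most `m ^ (2 * s)` pairs of `s`-sets and leaves room to sum
over `s`. -/
lemma exp_tail_le (hm : 0 < m) (hd : 512 * Real.log (4 * m) ≤ ε ^ 2 * (m * p)) {s : ℕ} {u : ℝ}
    (hu : u ≤ -(ε ^ 2 / 64 * (m * p)) * s) : Real.exp u ≤ ((m : ℝ) ^ (4 * s))⁻¹ := by
  have hm0 : (0 : ℝ) < m := by exact_mod_cast hm
  have hlog : 0 ≤ Real.log m := Real.log_nonneg (by exact_mod_cast hm)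
  have hlog4 : Real.log m ≤ Real.log (4 * m) := Real.log_le_log hm0 (by linarith)
  have : u ≤ (s : ℝ) * -(4 * Real.log m) := by
    refine hu.trans ?_
    rw [mul_comm]
    refine mul_le_mul_of_nonneg_left ?_ s.cast_nonneg
    linarith
  calc Real.exp u ≤ Real.exp (s * -(4 * Real.log m)) := Real.exp_le_exp.2 this
    _ = (Real.exp (Real.log m) ^ (4 * s))⁻¹ := by
      rw [← Real.exp_nat_mul, ← Real.exp_neg]
      congr 1
      push_cast
      ring
    _ = _ := by rw [Real.exp_log hm0]

lemma measureReal_starTriples_le (hε : 0 < ε) (hε1 : ε ≤ 1 / 4) (hm : 0 < m)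
    (hd : 512 * Real.log (4 * m) ≤ ε ^ 2 * (m * p)) (y : Fin m) :
    (Measure.pi fun _ : Fin m => bipartiteBinomialRandom (Fin m) (Fin m) p).real
      {G | (1 + ε / 4) * (m * (m * p)) ≤ edgeCount G (starTriples y)} ≤ ((m : ℝ) ^ 4)⁻¹ := by
  -- Half the relative deviation `ε / 4` minimises `t ^ 2 - t * ε / 4`, with value `-ε ^ 2 / 64`.
  refine (measureReal_le_edgeCount_le p _ (t := ε / 8) (by linarith) (by linarith) _).trans ?_
  refine exp_tail_le (s := 1) hm hd ?_
  rw [card_starTriples]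
  have h1 : (1 : ℝ) ≤ m := by exact_mod_cast hm
  have h2 : 0 ≤ ε ^ 2 / 64 * (m * p) := by have := p.2.1; positivity
  push_cast
  nlinarith

lemma measureReal_transversalTriples_singleton_le (hε : 0 < ε) (hε1 : ε ≤ 1 / 4) (hm : 0 < m)
    (hd : 512 * Real.log (4 * m) ≤ ε ^ 2 * (m * p)) (π : Equiv.Perm (Fin m)) (y : Fin m) :
    (Measure.pi fun _ : Fin m => bipartiteBinomialRandom (Fin m) (Fin m) p).real
      {G | (edgeCount G (transversalTriples π Finset.univ {y}) : ℝ) ≤ (1 - ε / 4) * (m * p)} ≤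
      ((m : ℝ) ^ 4)⁻¹ := by
  refine (measureReal_edgeCount_le_le p _ (t := ε / 8) (by linarith) (by linarith) _).trans ?_
  refine exp_tail_le (s := 1) hm hd ?_
  rw [card_transversalTriples, Finset.card_univ, Fintype.card_fin, Finset.card_singleton]
  push_cast
  apply le_of_eq
  ring

lemma measureReal_transversalTriples_le (hε : 0 < ε) (hε1 : ε ≤ 1 / 4) (hm : 0 < m)
    (hd : 512 * Real.log (4 * m) ≤ ε ^ 2 * (m * p)) (π : Equiv.Perm (Fin m))
    {S T : Finset (Fin m)} (hST : T.card = S.card) (hS : 2 * S.card ≤ m) :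
    (Measure.pi fun _ : Fin m => bipartiteBinomialRandom (Fin m) (Fin m) p).real
      {G | (1 / 2 + ε / 4) * (m * p) * S.card ≤ edgeCount G (transversalTriples π S T)} ≤
      ((m : ℝ) ^ (4 * S.card))⁻¹ := by
  refine (measureReal_le_edgeCount_le p _ (t := ε / 8) (by linarith) (by linarith) _).trans ?_
  refine exp_tail_le (s := S.card) hm hd ?_
  rw [card_transversalTriples, hST]
  -- This puts the mean `p * |S| ^ 2` below `m * p * |S| / 2`, the source of the `1/2` in the
  -- threshold.
  have hs : (2 : ℝ) * S.card ≤ m := by exact_mod_cast hS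
  have hp := p.2.1
  have h2 : 0 ≤ p * (ε / 8 + (ε / 8) ^ 2) * S.card := by positivity
  have h3 : 0 ≤ ε ^ 2 * (m * p) * S.card := by positivity
  push_cast
  nlinarith

lemma measureReal_not_isSpread_le (hε : 0 < ε) (hε1 : ε ≤ 1 / 4) (hm : 0 < m)
    (hd : 512 * Real.log (4 * m) ≤ ε ^ 2 * (m * p)) (π : Equiv.Perm (Fin m)) :
    (Measure.pi fun _ : Fin m => bipartiteBinomialRandom (Fin m) (Fin m) p).real
      {G | ¬ IsSpread (ε / 4) (m * p) G π} ≤ 2 / m := by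
  classical
  set μ := Measure.pi fun _ : Fin m => bipartiteBinomialRandom (Fin m) (Fin m) p
  have hm1 : (1 : ℝ) ≤ m := by exact_mod_cast hm
  have hm0 : (0 : ℝ) < m := by linarith
  let E₁ : Fin m → Set (Fin m → SimpleGraph (Fin m ⊕ Fin m)) := fun y =>
    {G | (edgeCount G (transversalTriples π Finset.univ {y}) : ℝ) ≤ (1 - ε / 4) * (m * p)}
  let P : Finset (Finset (Fin m) × Finset (Fin m)) := Finset.univ.filter fun t =>
    t.2.card = t.1.card ∧ 0 < t.1.card ∧ 2 * t.1.card ≤ m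
  let E₂ : Finset (Fin m) × Finset (Fin m) → Set (Fin m → SimpleGraph (Fin m ⊕ Fin m)) := fun t =>
    {G | (1 / 2 + ε / 4) * (m * p) * t.1.card ≤ edgeCount G (transversalTriples π t.1 t.2)}
  have hsub : {G | ¬ IsSpread (ε / 4) (m * p) G π} ⊆
      (⋃ y ∈ Finset.univ, E₁ y) ∪ ⋃ t ∈ P, E₂ t := by
    intro G hG
    by_contra hcon
    apply hG
    simp only [Set.mem_union, Set.mem_iUnion, not_or, not_exists] at hcon
    refine ⟨fun y => ?_, fun S T hT hS hSm => ?_⟩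
    · exact not_le.1 (hcon.1 y (Finset.mem_univ y))
    · exact not_le.1 (hcon.2 (S, T) (by simp [P, hT, hSm, Finset.card_pos.1 hS]))
  have h1 : μ.real (⋃ y ∈ Finset.univ, E₁ y) ≤ 1 / m := by
    refine (measureReal_biUnion_finset_le _ _).trans ?_
    refine (Finset.sum_le_card_nsmul _ _ _ fun y _ =>
      measureReal_transversalTriples_singleton_le hε hε1 hm hd π y).trans ?_
    rw [Finset.card_univ, Fintype.card_fin, nsmul_eq_mul, ← div_eq_mul_inv,
      div_le_div_iff₀ (by positivity) hm0]
    nlinarith [pow_le_pow_right₀ hm1 (show 2 ≤ 4 by norm_num)]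
  have h2 : μ.real (⋃ t ∈ P, E₂ t) ≤ 1 / m := by
    refine (measureReal_biUnion_finset_le _ _).trans ?_
    have hPE : ∀ t ∈ P, μ.real (E₂ t) ≤ ((m : ℝ) ^ (4 * t.1.card))⁻¹ := by
      intro t ht
      simp only [P, Finset.mem_filter, Finset.mem_univ, true_and] at ht
      exact measureReal_transversalTriples_le hε hε1 hm hd π ht.1 ht.2.2
    refine (Finset.sum_le_sum hPE).trans ?_
    rw [← Finset.sum_fiberwise_of_maps_to (t := Finset.Icc 1 m) (g := fun t => t.1.card)]
    · refine (Finset.sum_le_card_nsmul _ _ (((m : ℝ) ^ 2)⁻¹) fun s hs => ?_).trans ?_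
      · have hsub' : (P.filter fun t => t.1.card = s) ⊆
            (Finset.powersetCard s Finset.univ) ×ˢ (Finset.powersetCard s Finset.univ) := by
          intro t ht
          simp only [P, Finset.mem_filter, Finset.mem_univ, true_and, Finset.mem_product,
            Finset.mem_powersetCard_univ] at ht ⊢
          omega
        have hcard : ((P.filter fun t => t.1.card = s).card : ℝ) ≤ (m : ℝ) ^ (2 * s) := by
          have := Finset.card_le_card hsub'
          rw [Finset.card_product, Finset.card_powersetCard, Finset.card_univ,
            Fintype.card_fin] at this
          have h3 := Nat.mul_le_mul (Nat.choose_le_pow m s) (Nat.choose_le_pow m s)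
          rw [two_mul, pow_add]
          exact_mod_cast this.trans h3
        rw [Finset.sum_congr rfl fun t ht => by rw [(Finset.mem_filter.1 ht).2]]
        rw [Finset.sum_const, nsmul_eq_mul]
        calc ((P.filter fun t => t.1.card = s).card : ℝ) * ((m : ℝ) ^ (4 * s))⁻¹
            ≤ (m : ℝ) ^ (2 * s) * ((m : ℝ) ^ (4 * s))⁻¹ := by gcongr
          _ = ((m : ℝ) ^ (2 * s))⁻¹ := by
            rw [show 4 * s = 2 * s + 2 * s by ring, pow_add]
            field_simp
          _ ≤ ((m : ℝ) ^ 2)⁻¹ := by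
            have := (Finset.mem_Icc.1 hs).1
            gcongr
            omega
      · rw [Nat.card_Icc, Nat.add_sub_cancel, nsmul_eq_mul]
        apply le_of_eq
        field_simp
    · intro t ht
      simp only [P, Finset.mem_filter, Finset.mem_univ, true_and] at ht
      rw [Finset.mem_Icc]
      omega
  calc μ.real {G | ¬ IsSpread (ε / 4) (m * p) G π}
      ≤ μ.real ((⋃ y ∈ Finset.univ, E₁ y) ∪ ⋃ t ∈ P, E₂ t) := measureReal_mono hsub
    _ ≤ _ := measureReal_union_le _ _
    _ ≤ 1 / m + 1 / m := add_le_add h1 h2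
    _ = 2 / m := by ring

-- Markov's inequality for the number of non-spread permutations, whose mean is at most `m! * (2 /
-- m)`.
open scoped Classical in
lemma measureReal_many_not_isSpread_le (hε : 0 < ε) (hε1 : ε ≤ 1 / 4) (hm : 0 < m)
    (hd : 512 * Real.log (4 * m) ≤ ε ^ 2 * (m * p)) :
    (Measure.pi fun _ : Fin m => bipartiteBinomialRandom (Fin m) (Fin m) p).real
      {G | (m.factorial / 2 : ℝ) ≤
        (Finset.univ.filter fun π => ¬ IsSpread (ε / 4) (m * p) G π).card} ≤ 4 / m := by
  set μ := Measure.pi fun _ : Fin m => bipartiteBinomialRandom (Fin m) (Fin m) p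
  let f : (Fin m → SimpleGraph (Fin m ⊕ Fin m)) → ℝ := fun G =>
    ((Finset.univ.filter fun π => ¬ IsSpread (ε / 4) (m * p) G π).card : ℝ)
  have h1 : m.factorial / 2 * μ.real {G | (m.factorial / 2 : ℝ) ≤ f G} ≤ ∫ G, f G ∂μ :=
    mul_meas_ge_le_integral_of_nonneg (.of_forall fun G => Nat.cast_nonneg _)
      Integrable.of_finite _
  have h2 : ∫ G, f G ∂μ = ∑ π, μ.real {G | ¬ IsSpread (ε / 4) (m * p) G π} := by
    have : f = fun G => ∑ π : Equiv.Perm (Fin m),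
        Set.indicator {G | ¬ IsSpread (ε / 4) (m * p) G π} (fun _ => (1 : ℝ)) G := by
      ext G
      simp only [f, Finset.card_filter, Set.indicator_apply, Nat.cast_sum]
      refine Finset.sum_congr rfl fun π _ => ?_
      simp
    rw [this, integral_finsetSum _ fun _ _ => Integrable.of_finite]
    exact Finset.sum_congr rfl fun π _ => integral_indicator_one (Set.toFinite _).measurableSet
  have h3 := Finset.sum_le_card_nsmul Finset.univ _ _ fun π _ =>
    measureReal_not_isSpread_le hε hε1 hm hd π
  rw [Finset.card_univ, Fintype.card_perm, Fintype.card_fin, nsmul_eq_mul] at h3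
  have h4 : (0 : ℝ) < m.factorial / 2 := by
    have : (0 : ℝ) < m.factorial := by exact_mod_cast m.factorial_pos
    linarith
  refine le_of_mul_le_mul_left ((h1.trans (h2.le.trans h3)).trans (le_of_eq ?_)) h4
  ring

lemma measureReal_not_rainbow_le (hε : 0 < ε) (hε1 : ε ≤ 1 / 4) (hm : 0 < m)
    (hd : 512 * Real.log (4 * m) ≤ ε ^ 2 * (m * p)) :
    (Measure.pi fun _ : Fin m => bipartiteBinomialRandom (Fin m) (Fin m) p).real
      {G | ∀ H : Fin m → SimpleGraph (Fin m ⊕ Fin m), (∀ i, H i ≤ G i) →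
        (∀ i, (1 / 2 + ε) * (m * p) ≤ (minDeg (H i) : ℝ)) → HasRainbowPerfectMatching H}ᶜ ≤
      5 / m := by
  classical
  set μ := Measure.pi fun _ : Fin m => bipartiteBinomialRandom (Fin m) (Fin m) p
  have hm1 : (1 : ℝ) ≤ m := by exact_mod_cast hm
  have hm0 : (0 : ℝ) < m := by linarith
  let E₀ : Set (Fin m → SimpleGraph (Fin m ⊕ Fin m)) :=
    {G | ¬ ∀ i, G i ≤ completeBipartiteGraph (Fin m) (Fin m)}
  let E₁ : Fin m → Set (Fin m → SimpleGraph (Fin m ⊕ Fin m)) := fun y =>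
    {G | (1 + ε / 4) * (m * (m * p)) ≤ edgeCount G (starTriples y)}
  let E₂ : Set (Fin m → SimpleGraph (Fin m ⊕ Fin m)) := {G | (m.factorial / 2 : ℝ) ≤
    (Finset.univ.filter fun π => ¬ IsSpread (ε / 4) (m * p) G π).card}
  have h0 : μ.real E₀ = 0 := by
    rw [measureReal_def, show μ E₀ = 0 from ae_iff.1 (ae_le_completeBipartiteGraph p)]
    rfl
  have h1 : μ.real (⋃ y ∈ Finset.univ, E₁ y) ≤ 1 / m := by
    refine (measureReal_biUnion_finset_le _ _).trans ?_
    refine (Finset.sum_le_card_nsmul _ _ _ fun y _ =>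
      measureReal_starTriples_le hε hε1 hm hd y).trans ?_
    rw [Finset.card_univ, Fintype.card_fin, nsmul_eq_mul, ← div_eq_mul_inv,
      div_le_div_iff₀ (by positivity) hm0]
    nlinarith [pow_le_pow_right₀ hm1 (show 2 ≤ 4 by norm_num)]
  have h2 : μ.real E₂ ≤ 4 / m := measureReal_many_not_isSpread_le hε hε1 hm hd
  have hdm : (m : ℝ) * p ≤ m := mul_le_of_le_one_right hm0.le p.2.2
  refine (measureReal_mono (s₂ := E₀ ∪ ((⋃ y ∈ Finset.univ, E₁ y) ∪ E₂)) ?_).trans ?_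
  · intro G hG
    by_contra hcon
    simp only [Set.mem_union, Set.mem_iUnion, not_or, not_exists] at hcon
    obtain ⟨hc0, hc1, hc2⟩ := hcon
    refine hG fun H hHG hH => ?_
    exact hasRainbowPerfectMatching_of_spread hε hε1 hm hdm hd (not_not.1 hc0)
      (fun y => not_le.1 (hc1 y (Finset.mem_univ y))) (not_le.1 hc2) hHG hH
  · calc μ.real (E₀ ∪ ((⋃ y ∈ Finset.univ, E₁ y) ∪ E₂))
        ≤ μ.real E₀ + (μ.real (⋃ y ∈ Finset.univ, E₁ y) + μ.real E₂) :=
          (measureReal_union_le _ _).trans (by gcongr; exact measureReal_union_le _ _)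
      _ ≤ 0 + (1 / m + 4 / m) := by rw [h0]; gcongr
      _ = 5 / m := by ring

end Tail

/-! ### Passage to the limit -/

lemma tendsto_half_even : Tendsto (fun n : ℕ => n / 2) (atTop ⊓ 𝓟 {n : ℕ | Even n}) atTop :=
  (Nat.tendsto_div_const_atTop two_ne_zero).mono_left inf_le_left

theorem mainTheorem3 (ε : ℝ) (hε : 0 < ε) (p : ℕ → I)
    (hp : (fun n : ℕ => Real.log n / n) =o[atTop ⊓ 𝓟 {n : ℕ | Even n}]
      (fun n : ℕ => (p n : ℝ))) :
    Tendsto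
      (fun n : ℕ =>
        Measure.pi (fun _ : Fin (n / 2) =>
            bipartiteBinomialRandom (Fin (n / 2)) (Fin (n / 2)) (p n))
          {G : Fin (n / 2) → SimpleGraph (Fin (n / 2) ⊕ Fin (n / 2)) |
            ∀ H : Fin (n / 2) → SimpleGraph (Fin (n / 2) ⊕ Fin (n / 2)),
              (∀ i, H i ≤ G i) →
              (∀ i, (1 / 2 + ε) * ((n : ℝ) * (p n : ℝ) / 2) ≤ (minDeg (H i) : ℝ)) →
              HasRainbowPerfectMatching H})
      (atTop ⊓ 𝓟 {n : ℕ | Even n}) (𝓝 1) := by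
  -- A smaller `ε` only weakens the degree condition on `H`, so the case `ε ≤ 1/4` suffices.
  set ε₀ := min ε (1 / 4)
  have hε₀ : 0 < ε₀ := lt_min hε (by norm_num)
  have hlow : Tendsto (fun n : ℕ => 1 - ENNReal.ofReal (5 / ((n / 2 : ℕ) : ℝ)))
      (atTop ⊓ 𝓟 {n : ℕ | Even n}) (𝓝 1) := by
    have h1 : Tendsto (fun n : ℕ => (5 : ℝ) / ((n / 2 : ℕ) : ℝ))
        (atTop ⊓ 𝓟 {n : ℕ | Even n}) (𝓝 0) :=
      (tendsto_natCast_atTop_atTop.comp tendsto_half_even).const_div_atTop 5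
    have h2 := ENNReal.Tendsto.sub (a := 1) tendsto_const_nhds (ENNReal.tendsto_ofReal h1)
      (Or.inl ENNReal.one_ne_top)
    simpa using h2
  refine tendsto_of_tendsto_of_tendsto_of_le_of_le' hlow tendsto_const_nhds ?_
    (.of_forall fun n => prob_le_one)
  have hev : ∀ᶠ n : ℕ in atTop ⊓ 𝓟 {n : ℕ | Even n}, Even n :=
    mem_inf_of_right (mem_principal_self _)
  have hge : ∀ᶠ n : ℕ in atTop ⊓ 𝓟 {n : ℕ | Even n}, 2 ≤ n :=
    mem_inf_of_left (eventually_ge_atTop 2)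
  -- `2048 = 512 * 2 * 2`: one factor 2 from `log (4 * m) = log (2 * n) ≤ 2 * log n`, the other from
  -- `m = n / 2`.
  filter_upwards [hp.bound (show 0 < ε₀ ^ 2 / 2048 by positivity), hev, hge] with n hn hneven hn2
  have hn0 : (0 : ℝ) < n := by exact_mod_cast (by omega : 0 < n)
  have hn2' : (2 : ℝ) ≤ n := by exact_mod_cast hn2
  have hmn : ((n / 2 : ℕ) : ℝ) = n / 2 := by
    rw [Nat.cast_div hneven.two_dvd (by norm_num)]; norm_num
  set m := n / 2
  have hm : 0 < m := by omega
  have hlogn : 0 ≤ Real.log n := Real.log_nonneg (by linarith)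
  rw [Real.norm_of_nonneg (by positivity), Real.norm_of_nonneg (p n).2.1,
    div_le_iff₀ hn0] at hn
  have hd : 512 * Real.log (4 * m) ≤ ε₀ ^ 2 * (m * p n) := by
    have : Real.log (4 * m) ≤ 2 * Real.log n := by
      rw [hmn, ← Real.log_rpow hn0]
      refine Real.log_le_log (by positivity) ?_
      norm_num
      nlinarith
    refine (mul_le_mul_of_nonneg_left this (by norm_num)).trans ?_
    rw [hmn]
    linarith
  have hmain := measureReal_not_rainbow_le (p := p n) hε₀ (min_le_right _ _) hm hd
  set μ := Measure.pi fun _ : Fin m => bipartiteBinomialRandom (Fin m) (Fin m) (p n)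
  set R := {G : Fin m → SimpleGraph (Fin m ⊕ Fin m) | ∀ H : Fin m → SimpleGraph (Fin m ⊕ Fin m), (∀ i, H i ≤ G i) →
    (∀ i, (1 / 2 + ε₀) * (m * p n) ≤ (minDeg (H i) : ℝ)) → HasRainbowPerfectMatching H}
  have hR : 1 - ENNReal.ofReal (5 / (m : ℝ)) ≤ μ R := by
    have h1 : μ Rᶜ ≤ ENNReal.ofReal (5 / m) := by
      rw [← ofReal_measureReal]
      exact ENNReal.ofReal_le_ofReal hmain
    rw [tsub_le_iff_right]
    calc (1 : ENNReal) = μ (R ∪ Rᶜ) := by rw [Set.union_compl_self, measure_univ]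
      _ ≤ μ R + μ Rᶜ := measure_union_le _ _
      _ ≤ _ := by gcongr
  refine hR.trans (measure_mono fun G hG H hHG hH => hG H hHG fun i => le_trans ?_ (hH i))
  rw [hmn, show (n : ℝ) * p n / 2 = n / 2 * p n by ring]
  have := (p n).2.1
  gcongr
  exact min_le_left _ _
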